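/- \textbf{Definitions.} A \emph{Leibniz quantum compact metric space} $(\mathfrak A,\mathsf L)$ is a nonzero unital C*-algebra $\mathfrak A$ with a seminorm $\mathsf L$ defined on a dense Jordan--Lie subalgebra $\mathrm{dom}(\mathsf L)$ of the self-adjoint part $\mathfrak{sa}(\mathfrak A)$ (with $\mathsf L(a)=\infty$ for $a\notin\mathrm{dom}(\mathsf L)$) such that: $\{a:\mathsf L(a)=0\}=\mathbb R1_{\mathfrak A}$; the Monge--Kantorovich metric $\mathsf{mk}_{\mathsf L}(\varphi,\psi)=\sup\{|\varphi(a)-\psi(a)|:\mathsf L(a)\le 1\}$ metrizes the weak* topology of the state space $\mathscr S(\mathfrak A)$; $\mathsf L(\frac{ab+ba}{2})$ and $\mathsf L(\frac{ab-ba}{2i})$ are both at most $\|a\|\mathsf L(b)+\|b\|\mathsf L(a)$ for all $a,b\in\mathrm{dom}(\mathsf L)$; and $\mathsf L$ is lower semicontinuous for the norm. An \emph{isometric isomorphism} $h:(\mathfrak A,\mathsf L_{\mathfrak A})\to(\mathfrak B,\mathsf L_{\mathfrak B})$ is a *-isomorphism with $\mathsf L_{\mathfrak B}\circ h=\mathsf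 L_{\mathfrak A}$. A \emph{tunnel} $\tau=(\mathfrak D,\mathsf L_{\mathfrak D},\pi_1,\pi_2)$ from $(\mathfrak A_1,\mathsf L_1)$ to $(\mathfrak A_2,\mathsf L_2)$ is a Leibniz quantum compact metric space $(\mathfrak D,\mathsf L_{\mathfrak D})$ with *-epimorphisms $\pi_j:\mathfrak D\to\mathfrak A_j$ such that $\mathsf L_j(a)=\inf\{\mathsf L_{\mathfrak D}(d):d\in\mathfrak{sa}(\mathfrak D),\pi_j(d)=a\}$ for all $a\in\mathfrak{sa}(\mathfrak A_j)$, $j=1,2$. Its reverse is $\tau^{-1}=(\mathfrak D,\mathsf L_{\mathfrak D},\pi_2,\pi_1)$. Its \emph{extent} $\chi(\tau)$ is the maximum over $j=1,2$ of the Hausdorff distance for $\mathsf{mk}_{\mathsf L_{\mathfrak D}}$ between $\mathscr S(\mathfrak D)$ and $\{\varphi\circ\pi_j:\varphi\in\mathscr S(\mathfrak A_j)\}$. For $\varepsilon>0$, the \emph{$\varepsilon$-composition} of a tunnel $\tau_1=(\mathfrak D_1,\mathsf L_1,\pi_1,\pi_2)$ from $(\mathfrak A,\mathsf L_{\mathfrak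 A})$ to $(\mathfrak B,\mathsf L_{\mathfrak B})$ and a tunnel $\tau_2=(\mathfrak D_2,\mathsf L_2,\rho_1,\rho_2)$ from $(\mathfrak B,\mathsf L_{\mathfrak B})$ to $(\mathfrak E,\mathsf L_{\mathfrak E})$ is the tunnel $\tau_1\circ_\varepsilon\tau_2=(\mathfrak D_1\oplus\mathfrak D_2,\mathsf L,\pi_1\circ\eta_1,\rho_2\circ\eta_2)$ from $(\mathfrak A,\mathsf L_{\mathfrak A})$ to $(\mathfrak E,\mathsf L_{\mathfrak E})$, where $\eta_1,\eta_2$ are the canonical projections and $\mathsf L(d_1,d_2)=\max\{\mathsf L_1(d_1),\mathsf L_2(d_2),\frac1\varepsilon\|\pi_2(d_1)-\rho_1(d_2)\|_{\mathfrak B}\}$. Let $\mathcal C$ be a nonempty class of Leibniz quantum compact metric spaces. A class $\mathcal T$ of tunnels is \emph{appropriate} for $\mathcal C$ when: (1) any two elements of $\mathcal C$ are joined by a tunnel in $\mathcal T$; (2) if $h:(\mathfrak A,\mathsf L_{\mathfrak A})\to(\mathfrak B,\mathsf L_{\mathfrak B})$ is an isometric isomorphism between elements of $\mathcal C$, then $(\mathfrak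 A,\mathsf L_{\mathfrak A},\mathrm{id}_{\mathfrak A},h)$ and $(\mathfrak B,\mathsf L_{\mathfrak B},h^{-1},\mathrm{id}_{\mathfrak B})$ are in $\mathcal T$; (3) $\tau\in\mathcal T$ implies $\tau^{-1}\in\mathcal T$; (4) every tunnel in $\mathcal T$ is from and to elements of $\mathcal C$; (5) for every $\varepsilon>0$ and all $\tau_1,\tau_2\in\mathcal T$ such that $\tau_2$ starts at the space where $\tau_1$ ends, there is $\delta\in(0,\varepsilon]$ with $\tau_1\circ_\delta\tau_2\in\mathcal T$. \textbf{Theorem.} Let $\mathcal C$ be a nonempty class of Leibniz quantum compact metric spaces and let $\mathcal T$ be a class of tunnels appropriate for $\mathcal C$. For $(\mathfrak A,\mathsf L_{\mathfrak A}),(\mathfrak B,\mathsf L_{\mathfrak B})\in\mathcal C$ let $$\Lambda_{\mathcal T}((\mathfrak A,\mathsf L_{\mathfrak A}),(\mathfrak B,\mathsf L_{\mathfrak B}))=\inf\{\chi(\tau):\tau\in\mathcal T\text{ a tunnel from }(\mathfrak A,\mathsf L_{\mathfrak A})\text{ to }(\mathfrak B,\mathsf L_{\mathfrak B})\}.$$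 Then $\Lambda_{\mathcal T}$ takes values in $[0,\infty)$ on $\mathcal C\times\mathcal C$, and for all $(\mathfrak A,\mathsf L_{\mathfrak A}),(\mathfrak B,\mathsf L_{\mathfrak B}),(\mathfrak E,\mathsf L_{\mathfrak E})\in\mathcal C$, $$\Lambda_{\mathcal T}((\mathfrak A,\mathsf L_{\mathfrak A}),(\mathfrak E,\mathsf L_{\mathfrak E}))\le\Lambda_{\mathcal T}((\mathfrak A,\mathsf L_{\mathfrak A}),(\mathfrak B,\mathsf L_{\mathfrak B}))+\Lambda_{\mathcal T}((\mathfrak B,\mathsf L_{\mathfrak B}),(\mathfrak E,\mathsf L_{\mathfrak E})).$$ -/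

import Mathlib

open Set Filter Topology
open scoped ENNReal

universe u

noncomputable section

/-- The state space of a unital C*-algebra: positive unital linear functionals, with the topology
induced by the weak* topology of the dual. (Positive functionals are automatically continuous, and
a positive functional has norm one iff it maps the unit to one.) -/
abbrev StateSpace (A : Type u) [CStarAlgebra A] : Type u :=
  {φ : WeakDual ℂ A // φ 1 = 1 ∧ ∀ a : A, ∃ r : ℝ, 0 ≤ r ∧ φ (star a * a) = (r : ℂ)}

/-- The Monge-Kantorovich distance attached to `L`, as an extended nonnegative number:
the supremum of `|φ a - ψ a|` over all `a` with `L a ≤ 1`. -/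
def mongeKantorovich {A : Type u} [CStarAlgebra A] (L : A → ℝ≥0∞) (φ ψ : StateSpace A) : ℝ≥0∞ :=
  ⨆ (a : A) (_ : L a ≤ 1), edist (φ.1 a) (ψ.1 a)

/-- The state space with the Monge-Kantorovich distance is an extended pseudometric space. -/
abbrev mongeKantorovichSpace {A : Type u} [CStarAlgebra A] (L : A → ℝ≥0∞) :
    PseudoEMetricSpace (StateSpace A) where
  edist := mongeKantorovich L
  edist_self φ := by simp [mongeKantorovich]
  edist_comm φ ψ := by simp only [mongeKantorovich, edist_comm]
  edist_triangle φ ψ χ := by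
    refine iSup₂_le fun a ha => (edist_triangle _ (ψ.1 a) _).trans (add_le_add ?_ ?_)
    · exact le_iSup₂ (f := fun (a : A) (_ : L a ≤ 1) => edist (φ.1 a) (ψ.1 a)) a ha
    · exact le_iSup₂ (f := fun (a : A) (_ : L a ≤ 1) => edist (ψ.1 a) (χ.1 a)) a ha

/-- A Leibniz Lip-norm. The seminorm is extended by the value `∞` outside of its domain, so that
the domain is `{a | L a < ∞}`, which consists of self-adjoint elements. It is a real subspace by
`map_add_le` and `map_smul`, and a Jordan-Lie subalgebra by the two Leibniz inequalities. -/
structure LeibnizLipNorm (A : Type u) [CStarAlgebra A] where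
  toFun : A → ℝ≥0∞
  isSelfAdjoint_of_lt_top : ∀ a, toFun a < ⊤ → IsSelfAdjoint a
  dense_dom : ∀ a, IsSelfAdjoint a → a ∈ closure {b | toFun b < ⊤}
  map_add_le : ∀ a b, toFun (a + b) ≤ toFun a + toFun b
  map_smul : ∀ (r : ℝ) (a : A), toFun ((r : ℂ) • a) = ENNReal.ofReal |r| * toFun a
  eq_zero_iff : ∀ a, toFun a = 0 ↔ ∃ r : ℝ, a = (r : ℂ) • (1 : A)
  /-- the Monge-Kantorovich distance takes finite values -/
  mongeKantorovich_lt_top : ∀ φ ψ, mongeKantorovich toFun φ ψ < ⊤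
  /-- the Monge-Kantorovich distance induces the weak* topology on the state space -/
  metrizes : (mongeKantorovichSpace toFun).toUniformSpace.toTopologicalSpace =
    (inferInstance : TopologicalSpace (StateSpace A))
  leibniz_jordan : ∀ a b, toFun a < ⊤ → toFun b < ⊤ →
    toFun ((1 / 2 : ℂ) • (a * b + b * a)) ≤
      ENNReal.ofReal ‖a‖ * toFun b + ENNReal.ofReal ‖b‖ * toFun a
  leibniz_lie : ∀ a b, toFun a < ⊤ → toFun b < ⊤ →
    toFun ((1 / (2 * Complex.I) : ℂ) • (a * b - b * a)) ≤
      ENNReal.ofReal ‖a‖ * toFun b + ENNReal.ofReal ‖b‖ * toFun a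
  lowerSemicontinuous : LowerSemicontinuous toFun

/-- A Leibniz quantum compact metric space: a nonzero unital C*-algebra with a Leibniz Lip-norm. -/
structure LeibnizQCMS : Type (u + 1) where
  carrier : Type u
  [cstar : CStarAlgebra carrier]
  [nontrivial : Nontrivial carrier]
  lip : LeibnizLipNorm carrier

instance : CoeSort LeibnizQCMS.{u} (Type u) := ⟨LeibnizQCMS.carrier⟩

instance (A : LeibnizQCMS.{u}) : CStarAlgebra A := A.cstar

instance (A : LeibnizQCMS.{u}) : Nontrivial A := A.nontrivial

/-- The Lip-norm of a Leibniz quantum compact metric space, with value `∞` off its domain. -/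
abbrev LeibnizQCMS.L (A : LeibnizQCMS.{u}) : A → ℝ≥0∞ := A.lip.toFun

/-- An isometric isomorphism: a *-isomorphism `h` with `L_B ∘ h = L_A`. -/
structure IsometricIso (A B : LeibnizQCMS.{u}) where
  toEquiv : A ≃⋆ₐ[ℂ] B
  isometric : ∀ a, B.L (toEquiv a) = A.L a

/-- `π` is a *-epimorphism for which the Lip-norm of `A` is the quotient of that of `D`. -/
structure IsQuotientMorphism {D A : LeibnizQCMS.{u}} (π : D →⋆ₐ[ℂ] A) : Prop where
  surjective : Function.Surjective π
  quotient : ∀ a : A, IsSelfAdjoint a → A.L a = ⨅ (d : D) (_ : IsSelfAdjoint d ∧ π d = a), D.L d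

/-- A tunnel `(D, L_D, left, right)` from `A` to `B`. -/
structure Tunnel (A B : LeibnizQCMS.{u}) where
  D : LeibnizQCMS.{u}
  left : D →⋆ₐ[ℂ] A
  right : D →⋆ₐ[ℂ] B
  isQuotient_left : IsQuotientMorphism left
  isQuotient_right : IsQuotientMorphism right

/-- The transpose `φ ↦ φ ∘ π` between state spaces of a unital *-morphism. -/
def StateSpace.transpose {D A : Type u} [CStarAlgebra D] [CStarAlgebra A] (π : D →⋆ₐ[ℂ] A)
    (φ : StateSpace A) : StateSpace D :=
  ⟨(StrongDual.toWeakDual (((WeakDual.toStrongDual φ.1).toLinearMap ∘ₗ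
      π.toAlgHom.toLinearMap).mkContinuous ‖WeakDual.toStrongDual φ.1‖ (fun d =>
        ((WeakDual.toStrongDual φ.1).le_opNorm (π d)).trans
          (mul_le_mul_of_nonneg_left (NonUnitalStarAlgHom.norm_apply_le π d) (norm_nonneg _)))) :
      WeakDual ℂ D), by
    refine ⟨?_, fun a => ?_⟩
    · change φ.1 (π 1) = 1
      rw [map_one]; exact φ.2.1
    · change ∃ r : ℝ, 0 ≤ r ∧ φ.1 (π (star a * a)) = (r : ℂ)
      rw [map_mul, map_star]; exact φ.2.2 _⟩

@[simp] theorem StateSpace.transpose_apply {D A : Type u} [CStarAlgebra D] [CStarAlgebra A]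
    (π : D →⋆ₐ[ℂ] A) (φ : StateSpace A) (d : D) : (StateSpace.transpose π φ).1 d = φ.1 (π d) := rfl

/-- The Hausdorff distance between sets of states, for the Monge-Kantorovich distance of `D`. -/
def LeibnizQCMS.hausdorff (D : LeibnizQCMS.{u}) (s t : Set (StateSpace D)) : ℝ≥0∞ :=
  @Metric.hausdorffEDist _ (mongeKantorovichSpace D.L) s t

/-- The extent of a tunnel, as an extended nonnegative number. -/
def Tunnel.extent {A B : LeibnizQCMS.{u}} (τ : Tunnel A B) : ℝ≥0∞ :=
  max (τ.D.hausdorff univ (range (StateSpace.transpose τ.left)))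
    (τ.D.hausdorff univ (range (StateSpace.transpose τ.right)))

/-- The reversed tunnel. -/
def Tunnel.reverse {A B : LeibnizQCMS.{u}} (τ : Tunnel A B) : Tunnel B A where
  D := τ.D
  left := τ.right
  right := τ.left
  isQuotient_left := τ.isQuotient_right
  isQuotient_right := τ.isQuotient_left

theorem isQuotientMorphism_of_equiv {D A : LeibnizQCMS.{u}} (h : D ≃⋆ₐ[ℂ] A)
    (hL : ∀ d, A.L (h d) = D.L d) : IsQuotientMorphism (h : D →⋆ₐ[ℂ] A) where
  surjective := h.surjective
  quotient a ha := by
    apply le_antisymm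
    · refine le_iInf₂ fun d hd => ?_
      have : h d = a := hd.2
      rw [← this, hL]
    · obtain ⟨d, hd⟩ := h.surjective a
      have hd' : h d = a := hd
      subst hd'
      rw [hL]
      refine iInf₂_le d ⟨?_, rfl⟩
      have h1 : h (star d) = h d := by rw [map_star]; exact ha
      exact h.injective h1

theorem isQuotientMorphism_id (A : LeibnizQCMS.{u}) :
    IsQuotientMorphism (StarAlgHom.id ℂ A) where
  surjective := Function.surjective_id
  quotient a ha := le_antisymm (le_iInf₂ fun d hd => by
    have : d = a := hd.2
    rw [this]) (iInf₂_le a ⟨ha, rfl⟩)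

/-- The tunnel `(A, L_A, id, h)` from `A` to `B`. -/
def IsometricIso.tunnel {A B : LeibnizQCMS.{u}} (h : IsometricIso A B) : Tunnel A B where
  D := A
  left := StarAlgHom.id ℂ A
  right := (h.toEquiv : A →⋆ₐ[ℂ] B)
  isQuotient_left := isQuotientMorphism_id _
  isQuotient_right := isQuotientMorphism_of_equiv _ h.isometric

/-- The tunnel `(B, L_B, h⁻¹, id)` from `A` to `B`. -/
def IsometricIso.tunnel' {A B : LeibnizQCMS.{u}} (h : IsometricIso A B) : Tunnel A B where
  D := B
  left := (h.toEquiv.symm : B →⋆ₐ[ℂ] A)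
  right := StarAlgHom.id ℂ B
  isQuotient_left := isQuotientMorphism_of_equiv _ fun b => by
    rw [← h.isometric, StarAlgEquiv.apply_symm_apply]
  isQuotient_right := isQuotientMorphism_id _

theorem functional_norm_le {A : Type u} [CStarAlgebra A] (ω : A →ₗ[ℂ] ℂ)
    (hω : ∀ a : A, ∃ r : ℝ, 0 ≤ r ∧ ω (star a * a) = (r : ℂ)) (m : ℝ) (hm : ω 1 = (m : ℂ)) (a : A) :
    ‖ω a‖ ≤ 2 * ‖a‖ * m := by
  let _ := CStarAlgebra.spectralOrder A
  have _ := CStarAlgebra.spectralOrderedRing A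
  have key : ∀ a : A, IsSelfAdjoint a → ‖ω a‖ ≤ ‖a‖ * m := by
    intro a ha
    have h1 : ∃ x : ℝ, 0 ≤ x ∧ ω (algebraMap ℝ A ‖a‖ - a) = x := by
      obtain ⟨b, hb⟩ := CStarAlgebra.nonneg_iff_eq_star_mul_self.1
        (sub_nonneg.2 ha.le_algebraMap_norm_self)
      rw [hb]; exact hω b
    have h2 : ∃ x : ℝ, 0 ≤ x ∧ ω (a + algebraMap ℝ A ‖a‖) = x := by
      obtain ⟨b, hb⟩ := CStarAlgebra.nonneg_iff_eq_star_mul_self.1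
        (neg_le_iff_add_nonneg.1 ha.neg_algebraMap_norm_le_self)
      rw [hb]; exact hω b
    have h3 : ω (algebraMap ℝ A ‖a‖) = ((‖a‖ * m : ℝ) : ℂ) := by
      rw [Algebra.algebraMap_eq_smul_one, ← Complex.coe_smul, map_smul, hm]
      simp
    obtain ⟨x, hx, hx'⟩ := h1
    obtain ⟨y, hy, hy'⟩ := h2
    rw [map_sub, h3] at hx'
    rw [map_add, h3] at hy'
    have h4 : ω a = ((‖a‖ * m - x : ℝ) : ℂ) := by
      push_cast at hx' ⊢
      linear_combination -hx'
    rw [h4] at hy' ⊢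
    rw [Complex.norm_real, Real.norm_eq_abs, abs_le]
    have : (‖a‖ * m - x) + ‖a‖ * m = y := by exact_mod_cast hy'
    constructor <;> linarith
  have hdec := realPart_add_I_smul_imaginaryPart a
  have hr := key (realPart a : A) (realPart a).2
  have hi := key (imaginaryPart a : A) (imaginaryPart a).2
  have hm0 : 0 ≤ m := by
    obtain ⟨r, hr, h⟩ := hω 1
    rw [star_one, one_mul, hm] at h
    have : m = r := by exact_mod_cast h
    linarith
  have hr' : ‖(realPart a : A)‖ ≤ ‖a‖ := realPart.norm_le a
  have hi' : ‖(imaginaryPart a : A)‖ ≤ ‖a‖ := imaginaryPart.norm_le a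
  calc ‖ω a‖ = ‖ω (realPart a : A) + Complex.I * ω (imaginaryPart a : A)‖ := by
        conv_lhs => rw [← hdec]
        simp
    _ ≤ ‖ω (realPart a : A)‖ + ‖Complex.I * ω (imaginaryPart a : A)‖ := norm_add_le _ _
    _ = ‖ω (realPart a : A)‖ + ‖ω (imaginaryPart a : A)‖ := by simp
    _ ≤ ‖a‖ * m + ‖a‖ * m := by
        refine add_le_add (hr.trans ?_) (hi.trans ?_) <;> gcongr
    _ = _ := by ring

theorem StateSpace.norm_apply_le {A : Type u} [CStarAlgebra A] (φ : StateSpace A) (a : A) :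
    ‖φ.1 a‖ ≤ 2 * ‖a‖ := by
  have := functional_norm_le (WeakDual.toStrongDual φ.1).toLinearMap φ.2.2 1
    (by simpa using φ.2.1) a
  simpa using this

instance StateSpace.compactSpace (A : Type u) [CStarAlgebra A] : CompactSpace (StateSpace A) := by
  refine isCompact_iff_compactSpace.1 (WeakDual.isCompact_of_bounded_of_closed (𝕜 := ℂ) (E := A)
    (s := {φ : WeakDual ℂ A | φ 1 = 1 ∧ ∀ a : A, ∃ r : ℝ, 0 ≤ r ∧ φ (star a * a) = (r : ℂ)}) ?_ ?_)
  · refine (WeakDual.isBounded_closedBall (𝕜 := ℂ) (E := A) 0 2).subset fun φ hφ => ?_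
    simp only [mem_preimage, mem_closedBall_zero_iff]
    exact ContinuousLinearMap.opNorm_le_bound _ (by norm_num)
      fun a => StateSpace.norm_apply_le ⟨φ, hφ⟩ a
  · have hset : {φ : WeakDual ℂ A | φ 1 = 1 ∧
        ∀ a : A, ∃ r : ℝ, 0 ≤ r ∧ φ (star a * a) = (r : ℂ)} =
        {φ : WeakDual ℂ A | φ 1 = 1} ∩
          ⋂ a : A, {φ : WeakDual ℂ A | 0 ≤ (φ (star a * a)).re ∧ (φ (star a * a)).im = 0} := by
      ext φ
      simp only [mem_inter_iff, mem_iInter, mem_ofPred_eq]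
      refine and_congr_right fun _ => forall_congr' fun a => ⟨?_, fun h => ⟨_, h.1, ?_⟩⟩
      · rintro ⟨r, hr, h⟩
        simp [h, hr]
      · exact Complex.ext rfl (by simpa using h.2)
    rw [hset]
    refine IsClosed.inter (isClosed_eq (WeakDual.eval_continuous _) continuous_const)
      (isClosed_iInter fun a => ?_)
    have h1 : Continuous fun φ : WeakDual ℂ A => (φ (star a * a)).re :=
      Complex.continuous_re.comp (WeakDual.eval_continuous _)
    have h2 : Continuous fun φ : WeakDual ℂ A => (φ (star a * a)).im :=
      Complex.continuous_im.comp (WeakDual.eval_continuous _)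
    exact (isClosed_le continuous_const h1).inter (isClosed_eq h2 continuous_const)

instance StateSpace.nonempty (A : Type u) [CStarAlgebra A] [Nontrivial A] :
    Nonempty (StateSpace A) := by
  let _ := CStarAlgebra.spectralOrder A
  have _ := CStarAlgebra.spectralOrderedRing A
  obtain ⟨f, hf, hf1⟩ := exists_dual_vector ℂ (1 : A) (by simp)
  have hf1 : f 1 = 1 := by simpa using hf1
  have hbd : ∀ a, ‖f a‖ ≤ ‖a‖ := fun a => by simpa [hf] using f.le_opNorm a
  have him : ∀ a : A, IsSelfAdjoint a → (f a).im = 0 := by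
    intro a ha
    have h : ∀ n : ℝ, 2 * (f a).im * n ≤ ‖a‖ ^ 2 := by
      intro n
      have h1 := hbd (a + ((n : ℂ) * Complex.I) • 1)
      have h2 : ‖a + ((n : ℂ) * Complex.I) • (1 : A)‖ ^ 2 ≤ ‖a‖ ^ 2 + n ^ 2 := by
        rw [pow_two, ← CStarRing.norm_star_mul_self]
        have : star (a + ((n : ℂ) * Complex.I) • (1 : A)) * (a + ((n : ℂ) * Complex.I) • 1) =
            a * a + ((n ^ 2 : ℝ) : ℂ) • (1 : A) := by
          rw [star_add, star_smul, ha.star_eq, star_one]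
          simp only [add_mul, mul_add, smul_mul_assoc, mul_smul_comm, one_mul, mul_one]
          have hs : star ((n : ℂ) * Complex.I) = -((n : ℂ) * Complex.I) := by simp
          rw [hs]
          have h3 : ((n : ℂ) * Complex.I) * ((n : ℂ) * Complex.I) = -((n ^ 2 : ℝ) : ℂ) := by
            push_cast
            linear_combination ((n : ℂ) ^ 2) * Complex.I_sq
          rw [smul_add, smul_smul, mul_neg, h3]; module
        rw [this]
        refine (norm_add_le _ _).trans (add_le_add ?_ ?_)
        · rw [pow_two]; exact norm_mul_le _ _
        · rw [norm_smul, norm_one, mul_one, Complex.norm_real, Real.norm_eq_abs,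
            abs_of_nonneg (sq_nonneg n)]
      have h3 : f (a + ((n : ℂ) * Complex.I) • 1) = f a + n * Complex.I := by
        rw [map_add, map_smul, hf1]; simp
      rw [h3] at h1
      have h4 : ‖f a + n * Complex.I‖ ^ 2 = (f a).re ^ 2 + ((f a).im + n) ^ 2 := by
        rw [← Complex.normSq_eq_norm_sq, Complex.normSq_apply]; simp; ring
      have h5 : ‖f a + n * Complex.I‖ ^ 2 ≤ ‖a‖ ^ 2 + n ^ 2 :=
        (pow_le_pow_left₀ (norm_nonneg _) h1 2).trans h2
      rw [h4] at h5
      nlinarith [sq_nonneg (f a).re, sq_nonneg (f a).im]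
    by_contra hne
    have := h ((‖a‖ ^ 2 + 1) / (2 * (f a).im))
    rw [mul_div_cancel₀ _ (by simpa using hne)] at this
    linarith
  refine ⟨⟨StrongDual.toWeakDual f, hf1, fun b => ?_⟩⟩
  change ∃ r : ℝ, 0 ≤ r ∧ f (star b * b) = r
  have hsa : IsSelfAdjoint (star b * b) := IsSelfAdjoint.star_mul_self b
  set a := star b * b with ha
  have ha0 : 0 ≤ a := star_mul_self_nonneg b
  refine ⟨(f a).re, ?_, Complex.ext rfl (by simpa using him a hsa)⟩
  have h1 : ‖algebraMap ℝ A ‖a‖ - a‖ ≤ ‖a‖ := by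
    have h2 : algebraMap ℝ A ‖a‖ - a ≤ algebraMap ℝ A ‖a‖ := by simpa using ha0
    refine (CStarAlgebra.norm_le_norm_of_nonneg_of_le
      (sub_nonneg.2 hsa.le_algebraMap_norm_self) h2).trans ?_
    rw [norm_algebraMap']; simp
  have h2 := (Complex.re_le_norm _).trans ((hbd _).trans h1)
  have h3 : f (algebraMap ℝ A ‖a‖) = (‖a‖ : ℂ) := by
    rw [Algebra.algebraMap_eq_smul_one, ← Complex.coe_smul, map_smul, hf1]; simp
  rw [map_sub, h3, Complex.sub_re, Complex.ofReal_re] at h2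
  linarith

theorem edist_le_mongeKantorovich {A : Type u} [CStarAlgebra A] (L : A → ℝ≥0∞)
    (φ ψ : StateSpace A) (a : A) (ha : L a ≤ 1) :
    edist (φ.1 a) (ψ.1 a) ≤ mongeKantorovich L φ ψ :=
  le_iSup₂ (f := fun (a : A) (_ : L a ≤ 1) => edist (φ.1 a) (ψ.1 a)) a ha

theorem exists_diam_of_compact {X : Type u} [PseudoEMetricSpace X] [CompactSpace X]
    (h : ∀ x y : X, edist x y < ⊤) : ∃ M : ℝ≥0∞, M < ⊤ ∧ ∀ x y : X, edist x y ≤ M := by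
  rcases isEmpty_or_nonempty X with hX | ⟨⟨x₀⟩⟩
  · exact ⟨0, ENNReal.zero_lt_top, fun x => hX.elim x⟩
  have hcont : Continuous fun x : X => edist x x₀ := by fun_prop
  obtain ⟨x₁, -, h₁⟩ := isCompact_univ.exists_isMaxOn ⟨x₀, mem_univ _⟩ hcont.continuousOn
  refine ⟨edist x₁ x₀ + edist x₁ x₀, ENNReal.add_lt_top.2 ⟨h _ _, h _ _⟩, fun x y => ?_⟩
  refine (edist_triangle x x₀ y).trans (add_le_add (h₁ (mem_univ x)) ?_)
  rw [edist_comm]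
  exact h₁ (mem_univ y)

theorem LeibnizLipNorm.exists_diam {A : Type u} [CStarAlgebra A]
    (L : LeibnizLipNorm A) : ∃ M : ℝ≥0∞, M < ⊤ ∧ ∀ φ ψ, mongeKantorovich L.toFun φ ψ ≤ M :=
  @exists_diam_of_compact _ (mongeKantorovichSpace L.toFun)
    (by rw [L.metrizes]; exact StateSpace.compactSpace A) L.mongeKantorovich_lt_top

theorem topology_eq_coinduced {Y Z : Type u} [TopologicalSpace Y] [CompactSpace Y]
    [TopologicalSpace Z] [T2Space Z] (f : Y → Z) (hf : Continuous f) (hs : Function.Surjective f) :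
    (inferInstance : TopologicalSpace Z) = TopologicalSpace.coinduced f inferInstance :=
  (hf.isClosedMap.isQuotientMap hf hs).eq_coinduced

theorem topology_eq_coinduced_of_edist {X Y Z : Type u} [PseudoEMetricSpace X]
    [PseudoEMetricSpace Y] [PZ : PseudoEMetricSpace Z] [CompactSpace X] [CompactSpace Y]
    (f : unitInterval × X × Y → Z) (hs : Function.Surjective f) (K : ℝ≥0∞) (hK : K ≠ ⊤)
    (hfK : ∀ p q, edist (f p) (f q) ≤
      edist p.2.1 q.2.1 + edist p.2.2 q.2.2 + edist p.1 q.1 * K)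
    (hZ : ∀ x y : Z, edist x y = 0 → x = y) :
    PZ.toUniformSpace.toTopologicalSpace = TopologicalSpace.coinduced f inferInstance := by
  have hf : Continuous f := by
    rw [continuous_iff_continuousAt]
    intro q
    rw [ContinuousAt, tendsto_iff_edist_tendsto_0]
    refine tendsto_of_tendsto_of_tendsto_of_le_of_le tendsto_const_nhds ?_ (fun _ => zero_le)
      (fun p => hfK p q)
    have hc : Continuous fun p : unitInterval × X × Y =>
        edist p.2.1 q.2.1 + edist p.2.2 q.2.2 + edist p.1 q.1 * K := by
      refine Continuous.add (by fun_prop) (ENNReal.continuous_mul_const hK |>.comp (by fun_prop))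
    have := hc.tendsto q
    simpa using this
  let EZ : EMetricSpace Z := { PZ with eq_of_edist_eq_zero := fun {x y} h => hZ x y h }
  have hT : @T2Space Z EZ.toPseudoEMetricSpace.toUniformSpace.toTopologicalSpace := inferInstance
  have hT' : T2Space Z := hT
  exact topology_eq_coinduced f hf hs

theorem topology_eq_of_parametrization {X Y Z : Type u} [tX : TopologicalSpace X]
    [tY : TopologicalSpace Y] [tZ : TopologicalSpace Z] [CompactSpace X] [CompactSpace Y]
    [T2Space Z] (PX : PseudoEMetricSpace X) (PY : PseudoEMetricSpace Y) (PZ : PseudoEMetricSpace Z)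
    (hX : PX.toUniformSpace.toTopologicalSpace = tX)
    (hY : PY.toUniformSpace.toTopologicalSpace = tY)
    (f : unitInterval × X × Y → Z) (hf : Continuous f) (hs : Function.Surjective f)
    (K : ℝ≥0∞) (hK : K ≠ ⊤)
    (hfK : ∀ p q, edist (f p) (f q) ≤
      edist p.2.1 q.2.1 + edist p.2.2 q.2.2 + edist p.1 q.1 * K)
    (hZ : ∀ x y : Z, edist x y = 0 → x = y) :
    PZ.toUniformSpace.toTopologicalSpace = tZ := by
  subst hX hY
  exact (topology_eq_coinduced_of_edist f hs K hK hfK hZ).trans (topology_eq_coinduced f hf hs).symm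

/-- The convex combination `t φ₁ ∘ η₁ + (1 - t) φ₂ ∘ η₂` of states of the summands of
a direct sum. -/
def StateSpace.mix {A B : Type u} [CStarAlgebra A] [CStarAlgebra B] (t : unitInterval)
    (φ : StateSpace A) (ψ : StateSpace B) : StateSpace (A × B) :=
  ⟨((t : ℝ) : ℂ) • (StateSpace.transpose (StarAlgHom.fst ℂ A B) φ).1 +
    ((1 - (t : ℝ) : ℝ) : ℂ) • (StateSpace.transpose (StarAlgHom.snd ℂ A B) ψ).1, by
    constructor
    · change ((t : ℝ) : ℂ) * φ.1 1 + ((1 - (t : ℝ) : ℝ) : ℂ) * ψ.1 1 = 1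
      rw [φ.2.1, ψ.2.1]; push_cast; ring
    · intro a
      obtain ⟨r, hr, h⟩ := φ.2.2 a.1
      obtain ⟨s, hs, h'⟩ := ψ.2.2 a.2
      refine ⟨t * r + (1 - t) * s,
        add_nonneg (mul_nonneg t.2.1 hr) (mul_nonneg (sub_nonneg.2 t.2.2) hs), ?_⟩
      change ((t : ℝ) : ℂ) * φ.1 (star a.1 * a.1) +
        ((1 - (t : ℝ) : ℝ) : ℂ) * ψ.1 (star a.2 * a.2) = _
      rw [h, h']; push_cast; ring⟩

theorem StateSpace.mix_apply {A B : Type u} [CStarAlgebra A] [CStarAlgebra B] (t : unitInterval)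
    (φ : StateSpace A) (ψ : StateSpace B) (a : A × B) :
    (StateSpace.mix t φ ψ).1 a =
      ((t : ℝ) : ℂ) * φ.1 a.1 + ((1 - (t : ℝ) : ℝ) : ℂ) * ψ.1 a.2 := rfl

theorem StateSpace.exists_scaled {A : Type u} [CStarAlgebra A] [Nontrivial A] (ω : A →L[ℂ] ℂ)
    (hω : ∀ a : A, ∃ r : ℝ, 0 ≤ r ∧ ω (star a * a) = (r : ℂ)) (m : ℝ) (hm : ω 1 = (m : ℂ)) :
    ∃ φ : StateSpace A, ∀ a, ω a = (m : ℂ) * φ.1 a := by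
  by_cases h0 : m = 0
  · obtain ⟨φ⟩ := StateSpace.nonempty A
    refine ⟨φ, fun a => ?_⟩
    have := functional_norm_le ω.toLinearMap hω m hm a
    rw [h0, mul_zero] at this
    rw [h0, Complex.ofReal_zero, zero_mul]
    exact norm_le_zero_iff.1 this
  · have hm0 : 0 ≤ m := by
      obtain ⟨r, hr, h⟩ := hω 1
      rw [star_one, one_mul, hm] at h
      have : m = r := by exact_mod_cast h
      linarith
    have hmc : (m : ℂ) ≠ 0 := by exact_mod_cast h0
    refine ⟨⟨StrongDual.toWeakDual ((m : ℂ)⁻¹ • ω), ?_, fun a => ?_⟩, fun a => ?_⟩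
    · change (m : ℂ)⁻¹ * ω 1 = 1
      rw [hm, inv_mul_cancel₀ hmc]
    · obtain ⟨r, hr, h⟩ := hω a
      refine ⟨m⁻¹ * r, mul_nonneg (inv_nonneg.2 hm0) hr, ?_⟩
      change (m : ℂ)⁻¹ * ω (star a * a) = _
      rw [h]; push_cast; rfl
    · change _ = (m : ℂ) * ((m : ℂ)⁻¹ * ω a)
      rw [mul_inv_cancel_left₀ hmc]

theorem StateSpace.exists_mix {A B : Type u} [CStarAlgebra A] [CStarAlgebra B] [Nontrivial A]
    [Nontrivial B] (χ : StateSpace (A × B)) : ∃ t φ ψ, StateSpace.mix t φ ψ = χ := by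
  obtain ⟨r, hr, h1⟩ := χ.2.2 ((1, 0) : A × B)
  obtain ⟨s, hs, h2⟩ := χ.2.2 ((0, 1) : A × B)
  have e1 : star ((1, 0) : A × B) * (1, 0) = (1, 0) := by ext <;> simp
  have e2 : star ((0, 1) : A × B) * (0, 1) = (0, 1) := by ext <;> simp
  rw [e1] at h1
  rw [e2] at h2
  let F : (A × B) →L[ℂ] ℂ := WeakDual.toStrongDual χ.1
  have hrs : r + s = 1 := by
    have : χ.1 ((1, 0) + (0, 1) : A × B) = 1 := by
      refine Eq.trans ?_ χ.2.1
      congr 1; ext <;> simp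
    rw [map_add, h1, h2] at this
    exact_mod_cast this
  obtain ⟨φ, hφ⟩ := StateSpace.exists_scaled (F.comp (ContinuousLinearMap.inl ℂ A B))
    (fun a => by
      obtain ⟨x, hx, h⟩ := χ.2.2 ((a, 0) : A × B)
      refine ⟨x, hx, ?_⟩
      rw [← h]
      change χ.1 (star a * a, 0) = _
      congr 1; ext <;> simp) r h1
  obtain ⟨ψ, hψ⟩ := StateSpace.exists_scaled (F.comp (ContinuousLinearMap.inr ℂ A B))
    (fun a => by
      obtain ⟨x, hx, h⟩ := χ.2.2 ((0, a) : A × B)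
      refine ⟨x, hx, ?_⟩
      rw [← h]
      change χ.1 (0, star a * a) = _
      congr 1; ext <;> simp) s h2
  refine ⟨⟨r, hr, by linarith⟩, φ, ψ, Subtype.ext (DFunLike.ext _ _ fun a => ?_)⟩
  rw [StateSpace.mix_apply]
  have h3 : (1 - r : ℝ) = s := by linarith
  simp only [h3]
  rw [← hφ, ← hψ]
  change χ.1 (a.1, 0) + χ.1 (0, a.2) = χ.1 a
  rw [← map_add]; congr 1; ext <;> simp

theorem StateSpace.continuous_mix {A B : Type u} [CStarAlgebra A] [CStarAlgebra B] :
    Continuous fun p : unitInterval × StateSpace A × StateSpace B =>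
      StateSpace.mix p.1 p.2.1 p.2.2 := by
  refine Continuous.subtype_mk (WeakDual.continuous_of_continuous_eval fun a => ?_) _
  have h1 : Continuous fun p : unitInterval × StateSpace A × StateSpace B => p.2.1.1 a.1 :=
    (WeakDual.eval_continuous a.1).comp
      (continuous_subtype_val.comp (continuous_fst.comp continuous_snd))
  have h2 : Continuous fun p : unitInterval × StateSpace A × StateSpace B => p.2.2.1 a.2 :=
    (WeakDual.eval_continuous a.2).comp
      (continuous_subtype_val.comp (continuous_snd.comp continuous_snd))
  change Continuous fun p : unitInterval × StateSpace A × StateSpace B =>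
    (((p.1 : ℝ) : ℂ) * p.2.1.1 a.1 + ((1 - (p.1 : ℝ) : ℝ) : ℂ) * p.2.2.1 a.2)
  fun_prop

/-- The seminorm `max {L₁ d₁, L₂ d₂, ε⁻¹ ‖π d₁ - ρ d₂‖}` on `D₁ ⊕ D₂`. -/
def compositionSeminorm (ε : ℝ) {D₁ D₂ B : LeibnizQCMS.{u}} (π : D₁ →⋆ₐ[ℂ] B)
    (ρ : D₂ →⋆ₐ[ℂ] B) (d : D₁ × D₂) : ℝ≥0∞ :=
  max (max (D₁.L d.1) (D₂.L d.2)) (ENNReal.ofReal (1 / ε * ‖π d.1 - ρ d.2‖))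

section Composition

variable {ε : ℝ} {D₁ D₂ B : LeibnizQCMS.{u}} {π : D₁ →⋆ₐ[ℂ] B} {ρ : D₂ →⋆ₐ[ℂ] B}

theorem compositionSeminorm_lt_top {d : D₁ × D₂} :
    compositionSeminorm ε π ρ d < ⊤ ↔ D₁.L d.1 < ⊤ ∧ D₂.L d.2 < ⊤ := by
  simp only [compositionSeminorm, max_lt_iff, ENNReal.ofReal_lt_top, and_true]

theorem LeibnizQCMS.L_zero (D : LeibnizQCMS.{u}) : D.L 0 = 0 :=
  (D.lip.eq_zero_iff 0).2 ⟨0, by simp⟩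

theorem LeibnizQCMS.L_smul_one (D : LeibnizQCMS.{u}) (r : ℝ) : D.L ((r : ℂ) • 1) = 0 :=
  (D.lip.eq_zero_iff _).2 ⟨r, rfl⟩

theorem IsQuotientMorphism.L_le {D A : LeibnizQCMS.{u}} {π : D →⋆ₐ[ℂ] A}
    (h : IsQuotientMorphism π) (d : D) (hd : IsSelfAdjoint d) : A.L (π d) ≤ D.L d := by
  rw [h.quotient (π d) (hd.map π)]
  exact iInf₂_le d ⟨hd, rfl⟩

theorem IsQuotientMorphism.exists_lt {D A : LeibnizQCMS.{u}} {π : D →⋆ₐ[ℂ] A}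
    (h : IsQuotientMorphism π) {a : A} (ha : IsSelfAdjoint a) {r : ℝ≥0∞} (hr : A.L a < r) :
    ∃ d, IsSelfAdjoint d ∧ π d = a ∧ D.L d < r := by
  rw [h.quotient a ha] at hr
  simp only [iInf_lt_iff] at hr
  obtain ⟨d, ⟨hd, hd'⟩, h⟩ := hr
  exact ⟨d, hd, hd', h⟩

theorem mongeKantorovich_eq_zero {A : Type u} [CStarAlgebra A] (L : A → ℝ≥0∞)
    (hd : ∀ a, IsSelfAdjoint a → a ∈ closure {b | L b < ⊤})
    (hs : ∀ (r : ℝ) (a : A), L ((r : ℂ) • a) = ENNReal.ofReal |r| * L a)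
    (φ ψ : StateSpace A) (h : mongeKantorovich L φ ψ = 0) : φ = ψ := by
  have h1 : ∀ a, L a < ⊤ → φ.1 a = ψ.1 a := by
    intro a ha
    obtain ⟨r, hr0, hr⟩ : ∃ r : ℝ, 0 < r ∧ ENNReal.ofReal |r| * L a ≤ 1 := by
      refine ⟨((L a).toReal + 1)⁻¹, by positivity, ?_⟩
      have h2 : 0 < (L a).toReal + 1 := by positivity
      rw [← ENNReal.ofReal_toReal ha.ne, ← ENNReal.ofReal_mul (abs_nonneg _),
        ENNReal.ofReal_toReal ha.ne, abs_of_pos (inv_pos.2 h2), ← ENNReal.ofReal_one]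
      refine ENNReal.ofReal_le_ofReal ?_
      rw [inv_mul_le_iff₀ h2]; linarith
    have h3 := edist_le_mongeKantorovich L φ ψ ((r : ℂ) • a) (by rw [hs]; exact hr)
    rw [h, nonpos_iff_eq_zero, edist_eq_zero, map_smul, map_smul] at h3
    exact smul_right_injective ℂ (by exact_mod_cast hr0.ne' : (r : ℂ) ≠ 0) h3
  have h2 : ∀ a, IsSelfAdjoint a → φ.1 a = ψ.1 a := by
    intro a ha
    have hc : IsClosed {a : A | φ.1 a = ψ.1 a} :=
      isClosed_eq (WeakDual.toStrongDual φ.1).continuous (WeakDual.toStrongDual ψ.1).continuous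
    exact closure_minimal (fun b hb => h1 b hb) hc (hd a ha)
  refine Subtype.ext (DFunLike.ext _ _ fun a => ?_)
  rw [← realPart_add_I_smul_imaginaryPart a, map_add, map_add, map_smul, map_smul,
    h2 _ (realPart a).2, h2 _ (imaginaryPart a).2]

theorem norm_bridge_mul_le (π : D₁ →⋆ₐ[ℂ] B) (ρ : D₂ →⋆ₐ[ℂ] B) (a b : D₁ × D₂) :
    ‖π (a.1 * b.1) - ρ (a.2 * b.2)‖ ≤
      ‖a‖ * ‖π b.1 - ρ b.2‖ + ‖b‖ * ‖π a.1 - ρ a.2‖ := by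
  have h : π (a.1 * b.1) - ρ (a.2 * b.2) =
      π a.1 * (π b.1 - ρ b.2) + (π a.1 - ρ a.2) * ρ b.2 := by
    rw [map_mul, map_mul, mul_sub, sub_mul]; abel
  have h1 : ‖π a.1‖ ≤ ‖a‖ := (NonUnitalStarAlgHom.norm_apply_le π a.1).trans (norm_fst_le a)
  have h2 : ‖ρ b.2‖ ≤ ‖b‖ := (NonUnitalStarAlgHom.norm_apply_le ρ b.2).trans (norm_snd_le b)
  rw [h]
  refine (norm_add_le _ _).trans (add_le_add ?_ ?_)
  · exact (norm_mul_le _ _).trans (by gcongr)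
  · exact (norm_mul_le _ _).trans (by rw [mul_comm]; gcongr)

/-- The common part of the two Leibniz inequalities. -/
theorem compositionSeminorm_leibniz (hε : 0 < ε) (a b c : D₁ × D₂)
    (h₁ : D₁.L c.1 ≤ ENNReal.ofReal ‖a.1‖ * D₁.L b.1 + ENNReal.ofReal ‖b.1‖ * D₁.L a.1)
    (h₂ : D₂.L c.2 ≤ ENNReal.ofReal ‖a.2‖ * D₂.L b.2 + ENNReal.ofReal ‖b.2‖ * D₂.L a.2)
    (h₃ : ‖π c.1 - ρ c.2‖ ≤ ‖a‖ * ‖π b.1 - ρ b.2‖ + ‖b‖ * ‖π a.1 - ρ a.2‖) :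
    compositionSeminorm ε π ρ c ≤ ENNReal.ofReal ‖a‖ * compositionSeminorm ε π ρ b +
      ENNReal.ofReal ‖b‖ * compositionSeminorm ε π ρ a := by
  have hl : ∀ d : D₁ × D₂, D₁.L d.1 ≤ compositionSeminorm ε π ρ d := fun d =>
    (le_max_left _ _).trans (le_max_left _ _)
  have hr : ∀ d : D₁ × D₂, D₂.L d.2 ≤ compositionSeminorm ε π ρ d := fun d =>
    (le_max_right _ _).trans (le_max_left _ _)
  have hn : ∀ d : D₁ × D₂, ENNReal.ofReal (1 / ε * ‖π d.1 - ρ d.2‖) ≤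
    compositionSeminorm ε π ρ d := fun d => le_max_right _ _
  refine max_le (max_le ?_ ?_) ?_
  · refine h₁.trans (add_le_add (mul_le_mul' (ENNReal.ofReal_le_ofReal (norm_fst_le a)) (hl b))
      (mul_le_mul' (ENNReal.ofReal_le_ofReal (norm_fst_le b)) (hl a)))
  · refine h₂.trans (add_le_add (mul_le_mul' (ENNReal.ofReal_le_ofReal (norm_snd_le a)) (hr b))
      (mul_le_mul' (ENNReal.ofReal_le_ofReal (norm_snd_le b)) (hr a)))
  · refine le_trans ?_ (add_le_add (mul_le_mul' le_rfl (hn b)) (mul_le_mul' le_rfl (hn a)))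
    rw [← ENNReal.ofReal_mul (norm_nonneg _), ← ENNReal.ofReal_mul (norm_nonneg _),
      ← ENNReal.ofReal_add (by positivity) (by positivity)]
    refine ENNReal.ofReal_le_ofReal ?_
    calc 1 / ε * ‖π c.1 - ρ c.2‖
        ≤ 1 / ε * (‖a‖ * ‖π b.1 - ρ b.2‖ + ‖b‖ * ‖π a.1 - ρ a.2‖) := by gcongr
      _ = _ := by ring

theorem exists_cross_bound (hε : 0 < ε) (D₁ D₂ : LeibnizQCMS.{u}) (π : D₁ →⋆ₐ[ℂ] B)
    (ρ : D₂ →⋆ₐ[ℂ] B) : ∃ K : ℝ≥0∞, K < ⊤ ∧ ∀ (φ : StateSpace D₁) (ψ : StateSpace D₂)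
      (d : D₁ × D₂), compositionSeminorm ε π ρ d ≤ 1 → edist (φ.1 d.1) (ψ.1 d.2) ≤ K := by
  obtain ⟨M₁, hM₁, h₁⟩ := D₁.lip.exists_diam
  obtain ⟨M₂, hM₂, h₂⟩ := D₂.lip.exists_diam
  obtain ⟨χ⟩ := StateSpace.nonempty B
  refine ⟨M₁ + ENNReal.ofReal (2 * ε) + M₂, 
    ENNReal.add_lt_top.2 ⟨ENNReal.add_lt_top.2 ⟨hM₁, ENNReal.ofReal_lt_top⟩, hM₂⟩, fun φ ψ d hd => ?_⟩
  obtain ⟨⟨hd₁, hd₂⟩, hd₃⟩ : (D₁.L d.1 ≤ 1 ∧ D₂.L d.2 ≤ 1) ∧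
      ENNReal.ofReal (1 / ε * ‖π d.1 - ρ d.2‖) ≤ 1 := by
    simpa only [compositionSeminorm, max_le_iff] using hd
  have hb : ‖π d.1 - ρ d.2‖ ≤ ε := by
    rw [ENNReal.ofReal_le_one, one_div, inv_mul_le_iff₀ hε, mul_one] at hd₃
    exact hd₃
  have e1 : edist (φ.1 d.1) (χ.1 (π d.1)) ≤ M₁ :=
    (edist_le_mongeKantorovich D₁.L φ (StateSpace.transpose π χ) d.1 hd₁).trans (h₁ _ _)
  have e2 : edist (χ.1 (π d.1)) (χ.1 (ρ d.2)) ≤ ENNReal.ofReal (2 * ε) := by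
    rw [edist_dist, dist_eq_norm, ← map_sub]
    refine ENNReal.ofReal_le_ofReal ((StateSpace.norm_apply_le χ _).trans (by linarith))
  have e3 : edist (χ.1 (ρ d.2)) (ψ.1 d.2) ≤ M₂ :=
    (edist_le_mongeKantorovich D₂.L (StateSpace.transpose ρ χ) ψ d.2 hd₂).trans (h₂ _ _)
  exact (edist_triangle4 _ _ _ _).trans (add_le_add (add_le_add e1 e2) e3)

theorem mongeKantorovich_mix_le (K : ℝ≥0∞)
    (hK : ∀ (φ : StateSpace D₁) (ψ : StateSpace D₂) (d : D₁ × D₂),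
      compositionSeminorm ε π ρ d ≤ 1 → edist (φ.1 d.1) (ψ.1 d.2) ≤ K)
    (t s : unitInterval) (φ φ' : StateSpace D₁) (ψ ψ' : StateSpace D₂) :
    mongeKantorovich (compositionSeminorm ε π ρ) (StateSpace.mix t φ ψ) (StateSpace.mix s φ' ψ') ≤
      mongeKantorovich D₁.L φ φ' + mongeKantorovich D₂.L ψ ψ' + edist t s * K := by
  refine iSup₂_le fun d hd => ?_
  obtain ⟨⟨hd₁, hd₂⟩, -⟩ : (D₁.L d.1 ≤ 1 ∧ D₂.L d.2 ≤ 1) ∧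
      ENNReal.ofReal (1 / ε * ‖π d.1 - ρ d.2‖) ≤ 1 := by
    simpa only [compositionSeminorm, max_le_iff] using hd
  refine le_trans ?_ (add_le_add (add_le_add
    (edist_le_mongeKantorovich D₁.L φ φ' d.1 hd₁) (edist_le_mongeKantorovich D₂.L ψ ψ' d.2 hd₂))
    (mul_le_mul' le_rfl (hK φ' ψ' d hd)))
  rw [StateSpace.mix_apply, StateSpace.mix_apply]
  have ht : (edist t s) = edist (t : ℝ) (s : ℝ) := rfl
  rw [ht]
  simp only [edist_dist]
  rw [← ENNReal.ofReal_mul dist_nonneg, ← ENNReal.ofReal_add dist_nonneg dist_nonneg,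
    ← ENNReal.ofReal_add (add_nonneg dist_nonneg dist_nonneg)
      (mul_nonneg dist_nonneg dist_nonneg)]
  refine ENNReal.ofReal_le_ofReal ?_
  simp only [dist_eq_norm]
  have ht0 : ‖((t : ℝ) : ℂ)‖ ≤ 1 := by
    rw [Complex.norm_real, Real.norm_eq_abs, abs_of_nonneg t.2.1]; exact t.2.2
  have ht1 : ‖((1 - (t : ℝ) : ℝ) : ℂ)‖ ≤ 1 := by
    rw [Complex.norm_real, Real.norm_eq_abs, abs_of_nonneg (sub_nonneg.2 t.2.2)]
    linarith [t.2.1]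
  have hts : ‖(((t : ℝ) - (s : ℝ) : ℝ) : ℂ)‖ = ‖(t : ℝ) - (s : ℝ)‖ := Complex.norm_real _
  calc _ = ‖((t : ℝ) : ℂ) * (φ.1 d.1 - φ'.1 d.1) +
        ((1 - (t : ℝ) : ℝ) : ℂ) * (ψ.1 d.2 - ψ'.1 d.2) +
        (((t : ℝ) - (s : ℝ) : ℝ) : ℂ) * (φ'.1 d.1 - ψ'.1 d.2)‖ := by
        congr 1; push_cast; ring
    _ ≤ _ := by
        refine (norm_add_le _ _).trans (add_le_add ((norm_add_le _ _).trans (add_le_add ?_ ?_)) ?_)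
        · rw [norm_mul]
          exact mul_le_of_le_one_left (norm_nonneg _) ht0
        · rw [norm_mul]
          exact mul_le_of_le_one_left (norm_nonneg _) ht1
        · rw [norm_mul, hts]

theorem compositionSeminorm_smul (r : ℝ) (d : D₁ × D₂) :
    compositionSeminorm ε π ρ ((r : ℂ) • d) =
      ENNReal.ofReal |r| * compositionSeminorm ε π ρ d := by
  have h : 1 / ε * ‖π ((r : ℂ) • d).1 - ρ ((r : ℂ) • d).2‖ =
      |r| * (1 / ε * ‖π d.1 - ρ d.2‖) := by
    rw [Prod.smul_fst, Prod.smul_snd, map_smul, map_smul, ← smul_sub, norm_smul,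
      Complex.norm_real, Real.norm_eq_abs]
    ring
  have h1 := D₁.lip.map_smul r d.1
  have h2 := D₂.lip.map_smul r d.2
  rw [compositionSeminorm, h, Prod.smul_fst, Prod.smul_snd, LeibnizQCMS.L, LeibnizQCMS.L, h1, h2,
    ENNReal.ofReal_mul (abs_nonneg r), compositionSeminorm, mul_max, mul_max]

theorem compositionSeminorm_dense (a : D₁ × D₂) (ha : IsSelfAdjoint a) :
    a ∈ closure {b | compositionSeminorm ε π ρ b < ⊤} := by
  have : {b : D₁ × D₂ | compositionSeminorm ε π ρ b < ⊤} =
      {b | D₁.L b < ⊤} ×ˢ {b | D₂.L b < ⊤} := by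
    ext b; exact compositionSeminorm_lt_top
  rw [this, closure_prod_eq]
  exact ⟨D₁.lip.dense_dom _ (congrArg Prod.fst ha), D₂.lip.dense_dom _ (congrArg Prod.snd ha)⟩

/-- The Leibniz Lip-norm of the composition of tunnels. -/
def compositionLip (hε : 0 < ε) (D₁ D₂ : LeibnizQCMS.{u}) (π : D₁ →⋆ₐ[ℂ] B)
    (ρ : D₂ →⋆ₐ[ℂ] B) : LeibnizLipNorm (D₁ × D₂) where
  toFun := compositionSeminorm ε π ρ
  isSelfAdjoint_of_lt_top d hd := by
    rw [compositionSeminorm_lt_top] at hd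
    exact Prod.ext (D₁.lip.isSelfAdjoint_of_lt_top _ hd.1) (D₂.lip.isSelfAdjoint_of_lt_top _ hd.2)
  dense_dom := compositionSeminorm_dense
  map_add_le a b := by
    refine max_le (max_le ?_ ?_) ?_
    · exact (D₁.lip.map_add_le a.1 b.1).trans (add_le_add
        ((le_max_left _ _).trans (le_max_left _ _)) ((le_max_left _ _).trans (le_max_left _ _)))
    · exact (D₂.lip.map_add_le a.2 b.2).trans (add_le_add
        ((le_max_right _ _).trans (le_max_left _ _)) ((le_max_right _ _).trans (le_max_left _ _)))
    · refine le_trans ?_ (add_le_add (le_max_right _ _) (le_max_right _ _))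
      rw [← ENNReal.ofReal_add (by positivity) (by positivity), ← mul_add]
      refine ENNReal.ofReal_le_ofReal (mul_le_mul_of_nonneg_left ?_ (by positivity))
      have : π (a + b).1 - ρ (a + b).2 = (π a.1 - ρ a.2) + (π b.1 - ρ b.2) := by
        rw [Prod.fst_add, Prod.snd_add, map_add, map_add]; abel
      rw [this]
      exact norm_add_le _ _
  map_smul := compositionSeminorm_smul
  eq_zero_iff d := by
    constructor
    · intro h
      rw [compositionSeminorm, ← nonpos_iff_eq_zero, max_le_iff, max_le_iff] at h
      simp only [nonpos_iff_eq_zero] at h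
      obtain ⟨⟨h1, h2⟩, h3⟩ := h
      obtain ⟨r, hr⟩ := (D₁.lip.eq_zero_iff _).1 h1
      obtain ⟨s, hs⟩ := (D₂.lip.eq_zero_iff _).1 h2
      have h4 : 1 / ε * ‖π d.1 - ρ d.2‖ ≤ 0 := by rwa [ENNReal.ofReal_eq_zero] at h3
      have h5 : ‖π d.1 - ρ d.2‖ ≤ 0 := by
        rw [one_div, inv_mul_le_iff₀ hε, mul_zero] at h4; exact h4
      have h6 := norm_le_zero_iff.1 h5
      rw [hr, hs, map_smul, map_smul, map_one, map_one, ← sub_smul] at h6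
      have h7 : (r : ℂ) - s = 0 := (smul_eq_zero.1 h6).resolve_right one_ne_zero
      have h8 : (s : ℂ) = r := (sub_eq_zero.1 h7).symm
      exact ⟨r, Prod.ext hr (by rw [hs, h8]; rfl)⟩
    · rintro ⟨r, rfl⟩
      have h1 : D₁.L ((r : ℂ) • (1 : D₁ × D₂)).1 = 0 := D₁.L_smul_one r
      have h2 : D₂.L ((r : ℂ) • (1 : D₁ × D₂)).2 = 0 := D₂.L_smul_one r
      have h3 : π ((r : ℂ) • (1 : D₁ × D₂)).1 - ρ ((r : ℂ) • (1 : D₁ × D₂)).2 = 0 := by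
        rw [Prod.smul_fst, Prod.smul_snd, map_smul, map_smul, Prod.fst_one, Prod.snd_one,
          map_one, map_one, sub_self]
      rw [compositionSeminorm, h1, h2, h3]
      simp
  mongeKantorovich_lt_top χ χ' := by
    obtain ⟨K, hK, h⟩ := exists_cross_bound hε D₁ D₂ π ρ
    obtain ⟨t, φ, ψ, rfl⟩ := χ.exists_mix
    obtain ⟨s, φ', ψ', rfl⟩ := χ'.exists_mix
    refine (mongeKantorovich_mix_le K h t s φ φ' ψ ψ').trans_lt ?_
    exact ENNReal.add_lt_top.2 ⟨ENNReal.add_lt_top.2 ⟨D₁.lip.mongeKantorovich_lt_top _ _,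
      D₂.lip.mongeKantorovich_lt_top _ _⟩, ENNReal.mul_lt_top (edist_lt_top _ _) hK⟩
  metrizes := by
    obtain ⟨K, hK, h⟩ := exists_cross_bound hε D₁ D₂ π ρ
    refine topology_eq_of_parametrization (mongeKantorovichSpace D₁.L)
      (mongeKantorovichSpace D₂.L) (mongeKantorovichSpace (compositionSeminorm ε π ρ))
      D₁.lip.metrizes D₂.lip.metrizes (fun p => StateSpace.mix p.1 p.2.1 p.2.2)
      StateSpace.continuous_mix (fun χ => ?_) K hK.ne
      (fun p q => mongeKantorovich_mix_le K h _ _ _ _ _ _)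
      (mongeKantorovich_eq_zero _ compositionSeminorm_dense (compositionSeminorm_smul))
    obtain ⟨t, φ, ψ, rfl⟩ := χ.exists_mix
    exact ⟨⟨t, φ, ψ⟩, rfl⟩
  leibniz_jordan a b ha hb := by
    rw [compositionSeminorm_lt_top] at ha hb
    refine compositionSeminorm_leibniz hε a b _ (D₁.lip.leibniz_jordan _ _ ha.1 hb.1)
      (D₂.lip.leibniz_jordan _ _ ha.2 hb.2) ?_
    change ‖π ((1 / 2 : ℂ) • (a.1 * b.1 + b.1 * a.1)) -
      ρ ((1 / 2 : ℂ) • (a.2 * b.2 + b.2 * a.2))‖ ≤ _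
    rw [map_smul, map_smul, ← smul_sub, map_add, map_add, add_sub_add_comm, norm_smul]
    have h := (norm_add_le _ _).trans
      (add_le_add (norm_bridge_mul_le π ρ a b) (norm_bridge_mul_le π ρ b a))
    have h2 : ‖(1 / 2 : ℂ)‖ = 1 / 2 := by norm_num
    rw [h2]
    linarith
  leibniz_lie a b ha hb := by
    rw [compositionSeminorm_lt_top] at ha hb
    refine compositionSeminorm_leibniz hε a b _ (D₁.lip.leibniz_lie _ _ ha.1 hb.1)
      (D₂.lip.leibniz_lie _ _ ha.2 hb.2) ?_
    change ‖π ((1 / (2 * Complex.I) : ℂ) • (a.1 * b.1 - b.1 * a.1)) -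
      ρ ((1 / (2 * Complex.I) : ℂ) • (a.2 * b.2 - b.2 * a.2))‖ ≤ _
    rw [map_smul, map_smul, ← smul_sub, map_sub, map_sub, sub_sub_sub_comm, norm_smul]
    have h := (norm_sub_le _ _).trans
      (add_le_add (norm_bridge_mul_le π ρ a b) (norm_bridge_mul_le π ρ b a))
    have h2 : ‖(1 / (2 * Complex.I) : ℂ)‖ = 1 / 2 := by
      rw [norm_div, norm_mul, Complex.norm_I]; norm_num
    rw [h2]
    linarith
  lowerSemicontinuous := by
    have hπ : Continuous π :=
      AddMonoidHomClass.continuous_of_bound π 1 fun a => by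
        rw [one_mul]; exact NonUnitalStarAlgHom.norm_apply_le π a
    have hρ : Continuous ρ :=
      AddMonoidHomClass.continuous_of_bound ρ 1 fun a => by
        rw [one_mul]; exact NonUnitalStarAlgHom.norm_apply_le ρ a
    have h3 : Continuous fun d : D₁ × D₂ => ENNReal.ofReal (1 / ε * ‖π d.1 - ρ d.2‖) := by
      exact ENNReal.continuous_ofReal.comp (by fun_prop)
    exact ((D₁.lip.lowerSemicontinuous.comp continuous_fst).sup
      (D₂.lip.lowerSemicontinuous.comp continuous_snd)).sup h3.lowerSemicontinuous

/-- The direct sum `D₁ ⊕ D₂` with the Lip-norm of the composition of tunnels. -/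
def compositionSpace (hε : 0 < ε) (D₁ D₂ : LeibnizQCMS.{u}) (π : D₁ →⋆ₐ[ℂ] B)
    (ρ : D₂ →⋆ₐ[ℂ] B) : LeibnizQCMS.{u} where
  carrier := D₁ × D₂
  lip := compositionLip hε D₁ D₂ π ρ

/-- The first projection `η₁`. -/
def compositionSpace.fst (hε : 0 < ε) (D₁ D₂ : LeibnizQCMS.{u}) (π : D₁ →⋆ₐ[ℂ] B)
    (ρ : D₂ →⋆ₐ[ℂ] B) : compositionSpace hε D₁ D₂ π ρ →⋆ₐ[ℂ] D₁ :=
  StarAlgHom.fst ℂ D₁ D₂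

/-- The second projection `η₂`. -/
def compositionSpace.snd (hε : 0 < ε) (D₁ D₂ : LeibnizQCMS.{u}) (π : D₁ →⋆ₐ[ℂ] B)
    (ρ : D₂ →⋆ₐ[ℂ] B) : compositionSpace hε D₁ D₂ π ρ →⋆ₐ[ℂ] D₂ :=
  StarAlgHom.snd ℂ D₁ D₂

theorem compositionSpace.isQuotient_fst (hε : 0 < ε) (hπ : IsQuotientMorphism π)
    (hρ : IsQuotientMorphism ρ) {A : LeibnizQCMS.{u}} {σ : D₁ →⋆ₐ[ℂ] A}
    (hσ : IsQuotientMorphism σ) :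
    IsQuotientMorphism (σ.comp (compositionSpace.fst hε D₁ D₂ π ρ)) where
  surjective a := by
    obtain ⟨d, hd⟩ := hσ.surjective a
    exact ⟨((d, 0) : D₁ × D₂), hd⟩
  quotient a ha := by
    apply le_antisymm
    · refine le_iInf₂ fun d hd => ?_
      have h1 : σ (Prod.fst (d : D₁ × D₂)) = a := hd.2
      rw [← h1]
      exact (hσ.L_le _ (congrArg Prod.fst hd.1)).trans ((le_max_left _ _).trans (le_max_left _ _))
    · refine le_of_forall_gt fun r hr => ?_
      obtain ⟨d₁, hd₁, h₁, hr₁⟩ := hσ.exists_lt ha hr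
      obtain ⟨d₂, hd₂, h₂, hr₂⟩ := hρ.exists_lt (hd₁.map π) ((hπ.L_le d₁ hd₁).trans_lt hr₁)
      refine (iInf₂_le (((d₁, d₂) : D₁ × D₂) : compositionSpace hε D₁ D₂ π ρ)
        ⟨Prod.ext hd₁ hd₂, h₁⟩).trans_lt ?_
      change compositionSeminorm ε π ρ (d₁, d₂) < r
      simp only [compositionSeminorm, h₂, sub_self, norm_zero, mul_zero, ENNReal.ofReal_zero]
      exact max_lt (max_lt hr₁ hr₂) (pos_of_gt hr)

theorem compositionSpace.isQuotient_snd (hε : 0 < ε) (hπ : IsQuotientMorphism π)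
    (hρ : IsQuotientMorphism ρ) {A : LeibnizQCMS.{u}} {σ : D₂ →⋆ₐ[ℂ] A}
    (hσ : IsQuotientMorphism σ) :
    IsQuotientMorphism (σ.comp (compositionSpace.snd hε D₁ D₂ π ρ)) where
  surjective a := by
    obtain ⟨d, hd⟩ := hσ.surjective a
    exact ⟨((0, d) : D₁ × D₂), hd⟩
  quotient a ha := by
    apply le_antisymm
    · refine le_iInf₂ fun d hd => ?_
      have h1 : σ (Prod.snd (d : D₁ × D₂)) = a := hd.2
      rw [← h1]
      exact (hσ.L_le _ (congrArg Prod.snd hd.1)).trans ((le_max_right _ _).trans (le_max_left _ _))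
    · refine le_of_forall_gt fun r hr => ?_
      obtain ⟨d₂, hd₂, h₂, hr₂⟩ := hσ.exists_lt ha hr
      obtain ⟨d₁, hd₁, h₁, hr₁⟩ := hπ.exists_lt (hd₂.map ρ) ((hρ.L_le d₂ hd₂).trans_lt hr₂)
      refine (iInf₂_le (((d₁, d₂) : D₁ × D₂) : compositionSpace hε D₁ D₂ π ρ)
        ⟨Prod.ext hd₁ hd₂, h₂⟩).trans_lt ?_
      change compositionSeminorm ε π ρ (d₁, d₂) < r
      simp only [compositionSeminorm, h₁, sub_self, norm_zero, mul_zero, ENNReal.ofReal_zero]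
      exact max_lt (max_lt hr₁ hr₂) (pos_of_gt hr)

end Composition

/-- The `ε`-composition `(D₁ ⊕ D₂, L, π₁ ∘ η₁, ρ₂ ∘ η₂)` of the tunnels `τ₁ = (D₁, L₁, π₁, π₂)` and
`τ₂ = (D₂, L₂, ρ₁, ρ₂)`, where `L (d₁, d₂) = max {L₁ d₁, L₂ d₂, ε⁻¹ ‖π₂ d₁ - ρ₁ d₂‖}`. -/
def Tunnel.comp {A B E : LeibnizQCMS.{u}} (ε : ℝ) (hε : 0 < ε) (τ₁ : Tunnel A B)
    (τ₂ : Tunnel B E) : Tunnel A E where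
  D := compositionSpace hε τ₁.D τ₂.D τ₁.right τ₂.left
  left := τ₁.left.comp (compositionSpace.fst hε τ₁.D τ₂.D τ₁.right τ₂.left)
  right := τ₂.right.comp (compositionSpace.snd hε τ₁.D τ₂.D τ₁.right τ₂.left)
  isQuotient_left := compositionSpace.isQuotient_fst hε τ₁.isQuotient_right τ₂.isQuotient_left
    τ₁.isQuotient_left
  isQuotient_right := compositionSpace.isQuotient_snd hε τ₁.isQuotient_right τ₂.isQuotient_left
    τ₂.isQuotient_right

/-- A class of tunnels, given as the family of its subclasses of tunnels from `A` to `B`. -/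
abbrev TunnelClass : Type (u + 1) := ∀ A B : LeibnizQCMS.{u}, Set (Tunnel A B)

/-- A class of tunnels which is closed under compositions. -/
def ClosedUnderComposition (T : TunnelClass.{u}) : Prop :=
  ∀ ε : ℝ, 0 < ε → ∀ (A B E : LeibnizQCMS.{u}) (τ₁ : Tunnel A B) (τ₂ : Tunnel B E),
    τ₁ ∈ T A B → τ₂ ∈ T B E → ∃ (δ : ℝ) (hδ : 0 < δ), δ ≤ ε ∧ Tunnel.comp δ hδ τ₁ τ₂ ∈ T A E

/-- A class `T` of tunnels which is appropriate for a class `C` of Leibniz quantum compact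
metric spaces. -/
structure IsAppropriate (C : Set LeibnizQCMS.{u}) (T : TunnelClass.{u}) : Prop where
  exists_tunnel : ∀ A ∈ C, ∀ B ∈ C, (T A B).Nonempty
  isometricIso_mem : ∀ A ∈ C, ∀ B ∈ C, ∀ h : IsometricIso A B, h.tunnel ∈ T A B ∧ h.tunnel' ∈ T A B
  reverse_mem : ∀ (A B : LeibnizQCMS.{u}) (τ : Tunnel A B), τ ∈ T A B → τ.reverse ∈ T B A
  codomain_mem : ∀ (A B : LeibnizQCMS.{u}) (τ : Tunnel A B), τ ∈ T A B → A ∈ C ∧ B ∈ C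
  closedUnderComposition : ClosedUnderComposition T

/-- The Gromov-Hausdorff `T`-propinquity: the infimum of the extents of the tunnels
from `A` to `B` in `T`. -/
def propinquity (T : TunnelClass.{u}) (A B : LeibnizQCMS.{u}) : ℝ≥0∞ :=
  ⨅ τ ∈ T A B, Tunnel.extent τ

end

/-! The heart of the matter is the estimate χ(τ₁ ∘_ε τ₂) ≤ χ(τ₁) + χ(τ₂) + 2ε, reached in
`Tunnel.extent_comp_le` with any strict upper bounds r₁, r₂ in place of the two extents.

By `StateSpace.exists_mix`, every state of D₁ ⊕ D₂ is a convex combination of a state pulled back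
from D₁ and one pulled back from D₂. Closed Monge-Kantorovich balls behave convexly
(`mongeKantorovich_convexComb_le`) and transposes are affine. It is therefore enough to approximate
states of the two summands separately, which is the content of
`exists_mongeKantorovich_transpose_le`.

Pulling back along a coordinate projection does not increase distances
(`mongeKantorovich_transpose_le`), since each Lᵢ is dominated by the composed seminorm. A state of
D₁ is thus within r₁ of the states of A. A state of D₂ is within r₂ of a state β of B. The third
term of the composed seminorm forces the two pullbacks of β, through D₂ and through D₁, to lie
within 2ε of each other (`mongeKantorovich_bridge_le`), and from D₁ a further r₁ leads to A. The
same walk in the other direction reaches E.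

The triangle inequality follows by taking nearly optimal τ₁ and τ₂ and composing them with a small
parameter. Finiteness holds because the state space is compact for a finite-valued metric: it has
finite diameter, and this bounds the extent of any tunnel. -/

/-! ### Convexity of the state space and of the Monge-Kantorovich distance -/

/-- The convex combination `t φ + (1 - t) ψ` of two states of the same algebra. -/
noncomputable def StateSpace.convexComb {A : Type u} [CStarAlgebra A] (t : unitInterval)
    (φ ψ : StateSpace A) : StateSpace A :=
  StateSpace.transpose ((StarAlgHom.id ℂ A).prod (StarAlgHom.id ℂ A)) (StateSpace.mix t φ ψ)

theorem StateSpace.convexComb_apply {A : Type u} [CStarAlgebra A] (t : unitInterval)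
    (φ ψ : StateSpace A) (a : A) : (StateSpace.convexComb t φ ψ).1 a =
      ((t : ℝ) : ℂ) * φ.1 a + ((1 - (t : ℝ) : ℝ) : ℂ) * ψ.1 a := rfl

theorem StateSpace.transpose_convexComb {D A : Type u} [CStarAlgebra D] [CStarAlgebra A]
    (π : D →⋆ₐ[ℂ] A) (t : unitInterval) (φ ψ : StateSpace A) :
    StateSpace.transpose π (StateSpace.convexComb t φ ψ) =
      StateSpace.convexComb t (StateSpace.transpose π φ) (StateSpace.transpose π ψ) := rfl

/-- Presents a state of a direct sum as a combination of two states of one algebra, so that the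
convexity of the distance on that algebra applies to it. -/
theorem StateSpace.mix_eq_convexComb {A B : Type u} [CStarAlgebra A] [CStarAlgebra B]
    (t : unitInterval) (φ : StateSpace A) (ψ : StateSpace B) :
    StateSpace.mix t φ ψ = StateSpace.convexComb t
      (StateSpace.transpose (StarAlgHom.fst ℂ A B) φ)
      (StateSpace.transpose (StarAlgHom.snd ℂ A B) ψ) := rfl

/-- The difference of the two combinations is the combination, with the same weights, of x - x' and
y - y', and the closed ball of radius r about 0 is convex. -/
theorem edist_convexComb_le (t : unitInterval) {x y x' y' : ℂ} {r : ℝ≥0∞} (hx : edist x x' ≤ r)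
    (hy : edist y y' ≤ r) :
    edist (((t : ℝ) : ℂ) * x + ((1 - (t : ℝ) : ℝ) : ℂ) * y)
      (((t : ℝ) : ℂ) * x' + ((1 - (t : ℝ) : ℝ) : ℂ) * y') ≤ r := by
  -- An infinite radius makes the bound trivial; a finite one lets everything be restated with real
  -- norms.
  rcases eq_or_ne r ⊤ with rfl | hr
  · exact le_top
  lift r to NNReal using hr
  rw [edist_nndist, ENNReal.coe_le_coe, ← NNReal.coe_le_coe, coe_nndist, dist_eq_norm] at *
  have h0 : 0 ≤ 1 - (t : ℝ) := sub_nonneg.2 t.2.2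
  calc _ = ‖((t : ℝ) : ℂ) * (x - x') + ((1 - (t : ℝ) : ℝ) : ℂ) * (y - y')‖ := by congr 1; ring
    _ ≤ (t : ℝ) * ‖x - x'‖ + (1 - (t : ℝ)) * ‖y - y'‖ := by
        refine (norm_add_le _ _).trans_eq ?_
        rw [norm_mul, norm_mul, Complex.norm_of_nonneg t.2.1, Complex.norm_of_nonneg h0]
    _ ≤ (t : ℝ) * r + (1 - (t : ℝ)) * r :=
        add_le_add (mul_le_mul_of_nonneg_left hx t.2.1) (mul_le_mul_of_nonneg_left hy h0)
    _ = r := by ring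

/-- The scalar estimate holds for each test element of the Lip-ball with the same r, so it survives
the supremum. Both combinations must carry the same weight t. -/
theorem mongeKantorovich_convexComb_le {A : Type u} [CStarAlgebra A] {L : A → ℝ≥0∞}
    (t : unitInterval) {φ ψ φ' ψ' : StateSpace A} {r : ℝ≥0∞}
    (hφ : mongeKantorovich L φ φ' ≤ r) (hψ : mongeKantorovich L ψ ψ' ≤ r) :
    mongeKantorovich L (StateSpace.convexComb t φ ψ) (StateSpace.convexComb t φ' ψ') ≤ r :=
  iSup₂_le fun a ha => edist_convexComb_le t
    ((edist_le_mongeKantorovich L φ φ' a ha).trans hφ)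
    ((edist_le_mongeKantorovich L ψ ψ' a ha).trans hψ)

/-! ### Metric properties and contraction under pullback -/

theorem mongeKantorovich_comm {A : Type u} [CStarAlgebra A] (L : A → ℝ≥0∞)
    (φ ψ : StateSpace A) : mongeKantorovich L φ ψ = mongeKantorovich L ψ φ :=
  (mongeKantorovichSpace L).edist_comm φ ψ

theorem mongeKantorovich_triangle {A : Type u} [CStarAlgebra A] (L : A → ℝ≥0∞)
    (φ ψ χ : StateSpace A) :
    mongeKantorovich L φ χ ≤ mongeKantorovich L φ ψ + mongeKantorovich L ψ χ :=
  (mongeKantorovichSpace L).edist_triangle φ ψ χ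

/-- The hypothesis says that π sends the Lip-ball of D into that of A, so the left side is a
supremum over fewer test elements. -/
theorem mongeKantorovich_transpose_le {D A : Type u} [CStarAlgebra D] [CStarAlgebra A]
    {L : D → ℝ≥0∞} {L' : A → ℝ≥0∞} (π : D →⋆ₐ[ℂ] A) (h : ∀ d, L' (π d) ≤ L d)
    (φ ψ : StateSpace A) :
    mongeKantorovich L (StateSpace.transpose π φ) (StateSpace.transpose π ψ) ≤
      mongeKantorovich L' φ ψ :=
  iSup₂_le fun d hd => edist_le_mongeKantorovich L' φ ψ (π d) ((h d).trans hd)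

/-! ### Extents in terms of approximating states -/

/-- Only one half of the Hausdorff distance matters: points of s already lie in the whole state
space, so the other half is zero. -/
theorem LeibnizQCMS.hausdorff_univ_le (D : LeibnizQCMS.{u}) {s : Set (StateSpace D)} {r : ℝ≥0∞}
    (h : ∀ φ, ∃ ψ ∈ s, mongeKantorovich D.L φ ψ ≤ r) : D.hausdorff univ s ≤ r := by
  refine @Metric.hausdorffEDist_le_of_mem_edist _ (mongeKantorovichSpace D.L) _ _ _
    (fun φ _ => h φ) fun φ _ => ⟨φ, mem_univ φ, ?_⟩
  rw [(mongeKantorovichSpace D.L).edist_self φ]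
  exact zero_le

/-- The strict inequality yields an actual nearby state without having to show that an infimum is
attained. -/
theorem LeibnizQCMS.exists_lt_of_hausdorff_univ_lt (D : LeibnizQCMS.{u})
    {s : Set (StateSpace D)} {r : ℝ≥0∞} (h : D.hausdorff univ s < r) (φ : StateSpace D) :
    ∃ ψ ∈ s, mongeKantorovich D.L φ ψ < r :=
  @Metric.exists_edist_lt_of_hausdorffEDist_lt _ (mongeKantorovichSpace D.L) _ _ _ _
    (mem_univ φ) h

theorem Tunnel.exists_left_lt {A B : LeibnizQCMS.{u}} (τ : Tunnel A B) {r : ℝ≥0∞}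
    (h : τ.extent < r) (φ : StateSpace τ.D) :
    ∃ α, mongeKantorovich τ.D.L φ (StateSpace.transpose τ.left α) < r := by
  obtain ⟨_, ⟨α, rfl⟩, hα⟩ :=
    τ.D.exists_lt_of_hausdorff_univ_lt ((le_max_left _ _).trans_lt h) φ
  exact ⟨α, hα⟩

theorem Tunnel.exists_right_lt {A B : LeibnizQCMS.{u}} (τ : Tunnel A B) {r : ℝ≥0∞}
    (h : τ.extent < r) (φ : StateSpace τ.D) :
    ∃ α, mongeKantorovich τ.D.L φ (StateSpace.transpose τ.right α) < r := by
  obtain ⟨_, ⟨α, rfl⟩, hα⟩ :=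
    τ.D.exists_lt_of_hausdorff_univ_lt ((le_max_right _ _).trans_lt h) φ
  exact ⟨α, hα⟩

theorem Tunnel.extent_le {A B : LeibnizQCMS.{u}} (τ : Tunnel A B) {r : ℝ≥0∞}
    (hl : ∀ φ, ∃ α, mongeKantorovich τ.D.L φ (StateSpace.transpose τ.left α) ≤ r)
    (hr : ∀ φ, ∃ α, mongeKantorovich τ.D.L φ (StateSpace.transpose τ.right α) ≤ r) :
    τ.extent ≤ r := by
  refine max_le (τ.D.hausdorff_univ_le fun φ => ?_) (τ.D.hausdorff_univ_le fun φ => ?_)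
  · obtain ⟨α, hα⟩ := hl φ
    exact ⟨_, ⟨α, rfl⟩, hα⟩
  · obtain ⟨α, hα⟩ := hr φ
    exact ⟨_, ⟨α, rfl⟩, hα⟩

/-- The Monge-Kantorovich diameter of the state space of D is finite, so a single state of A and a
single state of B, chosen arbitrarily, already approximate every state within that diameter. -/
theorem Tunnel.extent_lt_top {A B : LeibnizQCMS.{u}} (τ : Tunnel A B) : τ.extent < ⊤ := by
  obtain ⟨M, hM, h⟩ := τ.D.lip.exists_diam
  obtain ⟨α⟩ := StateSpace.nonempty A
  obtain ⟨β⟩ := StateSpace.nonempty B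
  exact (τ.extent_le (fun φ => ⟨α, h _ _⟩) fun φ => ⟨β, h _ _⟩).trans_lt hM

/-! ### The extent of a composed tunnel -/

section CompositionExtent

variable {ε : ℝ} {D₁ D₂ B : LeibnizQCMS.{u}} {π : D₁ →⋆ₐ[ℂ] B} {ρ : D₂ →⋆ₐ[ℂ] B}

theorem L_fst_le_compositionSeminorm (d : D₁ × D₂) : D₁.L d.1 ≤ compositionSeminorm ε π ρ d :=
  (le_max_left _ _).trans (le_max_left _ _)

theorem L_snd_le_compositionSeminorm (d : D₁ × D₂) : D₂.L d.2 ≤ compositionSeminorm ε π ρ d :=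
  (le_max_right _ _).trans (le_max_left _ _)

/-- The two pullbacks to `D₁ ⊕ D₂` of a state of `B` are at distance at most `2 ε`. -/
theorem mongeKantorovich_bridge_le (hε : 0 < ε) (β : StateSpace B) :
    mongeKantorovich (compositionSeminorm ε π ρ)
      (StateSpace.transpose (StarAlgHom.fst ℂ D₁ D₂) (StateSpace.transpose π β))
      (StateSpace.transpose (StarAlgHom.snd ℂ D₁ D₂) (StateSpace.transpose ρ β)) ≤
        ENNReal.ofReal (2 * ε) := by
  refine iSup₂_le fun d hd => ?_
  -- The third term of the seminorm, once cleared of 1/ε, reads ‖π d₁ - ρ d₂‖ ≤ ε.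
  have h := (le_max_right _ _).trans hd
  rw [ENNReal.ofReal_le_one, one_div, inv_mul_le_iff₀ hε, mul_one] at h
  change edist (β.1 (π d.1)) (β.1 (ρ d.2)) ≤ _
  rw [edist_dist, dist_eq_norm, ← map_sub]
  -- The factor 2 comes from the crude bound ‖β b‖ ≤ 2‖b‖; it does no harm, since ε is taken
  -- arbitrarily small in the end.
  exact ENNReal.ofReal_le_ofReal ((StateSpace.norm_apply_le β _).trans (by linarith))

/-- To approximate all states of `D₁ ⊕ D₂` by states of a quotient, it suffices to approximate
those coming from the two summands. -/
theorem exists_mongeKantorovich_transpose_le {A : Type u} [CStarAlgebra A]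
    (σ : D₁ × D₂ →⋆ₐ[ℂ] A) {r : ℝ≥0∞}
    (h₁ : ∀ φ : StateSpace D₁, ∃ α, mongeKantorovich (compositionSeminorm ε π ρ)
      (StateSpace.transpose (StarAlgHom.fst ℂ D₁ D₂) φ) (StateSpace.transpose σ α) ≤ r)
    (h₂ : ∀ ψ : StateSpace D₂, ∃ α, mongeKantorovich (compositionSeminorm ε π ρ)
      (StateSpace.transpose (StarAlgHom.snd ℂ D₁ D₂) ψ) (StateSpace.transpose σ α) ≤ r)
    (χ : StateSpace (D₁ × D₂)) :
    ∃ α, mongeKantorovich (compositionSeminorm ε π ρ) χ (StateSpace.transpose σ α) ≤ r := by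
  obtain ⟨t, φ, ψ, rfl⟩ := χ.exists_mix
  obtain ⟨α, hα⟩ := h₁ φ
  obtain ⟨α', hα'⟩ := h₂ ψ
  -- The approximants are mixed with the weight t of χ itself, as the convexity estimate demands.
  refine ⟨StateSpace.convexComb t α α', ?_⟩
  rw [StateSpace.transpose_convexComb, StateSpace.mix_eq_convexComb]
  exact mongeKantorovich_convexComb_le t hα hα'

end CompositionExtent

/-- For each end of the composed tunnel, states of the adjacent summand are reached through one
tunnel alone; states of the far summand cross through B, at a cost of r₁, r₂ and the 2ε of the
bridge. -/
theorem Tunnel.extent_comp_le {A B E : LeibnizQCMS.{u}} {ε : ℝ} (hε : 0 < ε) (τ₁ : Tunnel A B)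
    (τ₂ : Tunnel B E) {r₁ r₂ : ℝ≥0∞} (h₁ : τ₁.extent < r₁) (h₂ : τ₂.extent < r₂) :
    (Tunnel.comp ε hε τ₁ τ₂).extent ≤ r₁ + r₂ + ENNReal.ofReal (2 * ε) := by
  have hfst := mongeKantorovich_transpose_le (StarAlgHom.fst ℂ τ₁.D τ₂.D)
    (L_fst_le_compositionSeminorm (ε := ε) (π := τ₁.right) (ρ := τ₂.left))
  have hsnd := mongeKantorovich_transpose_le (StarAlgHom.snd ℂ τ₁.D τ₂.D)
    (L_snd_le_compositionSeminorm (ε := ε) (π := τ₁.right) (ρ := τ₂.left))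
  refine Tunnel.extent_le _ ?_ ?_
  · refine exists_mongeKantorovich_transpose_le
      (τ₁.left.comp (StarAlgHom.fst ℂ τ₁.D τ₂.D)) (fun φ => ?_) fun ψ => ?_
    · obtain ⟨α, hα⟩ := τ₁.exists_left_lt h₁ φ
      refine ⟨α, ((hfst _ _).trans hα.le).trans ?_⟩
      rw [add_assoc]
      exact le_self_add
    -- The path is ψ to β ∘ `τ₂.left` inside D₂ (r₂), across the bridge to β ∘ `τ₁.right` (2ε), then
    -- to α ∘ `τ₁.left` inside D₁ (r₁).
    · obtain ⟨β, hβ⟩ := τ₂.exists_left_lt h₂ ψ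
      obtain ⟨α, hα⟩ := τ₁.exists_left_lt h₁ (StateSpace.transpose τ₁.right β)
      refine ⟨α, ((mongeKantorovich_triangle _ _ _ _).trans (add_le_add ((hsnd _ _).trans hβ.le)
        ((mongeKantorovich_triangle _ _ _ _).trans (add_le_add
          ((mongeKantorovich_comm _ _ _).trans_le (mongeKantorovich_bridge_le hε β))
          ((hfst _ _).trans hα.le))))).trans_eq ?_⟩
      ring
  · refine exists_mongeKantorovich_transpose_le
      (τ₂.right.comp (StarAlgHom.snd ℂ τ₁.D τ₂.D)) (fun φ => ?_) fun ψ => ?_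
    -- The mirror path, from D₁ through β to the states of E, crosses the bridge in its stated
    -- direction.
    · obtain ⟨β, hβ⟩ := τ₁.exists_right_lt h₁ φ
      obtain ⟨α, hα⟩ := τ₂.exists_right_lt h₂ (StateSpace.transpose τ₂.left β)
      refine ⟨α, ((mongeKantorovich_triangle _ _ _ _).trans (add_le_add ((hfst _ _).trans hβ.le)
        ((mongeKantorovich_triangle _ _ _ _).trans (add_le_add
          (mongeKantorovich_bridge_le hε β) ((hsnd _ _).trans hα.le))))).trans_eq ?_⟩
      ring
    · obtain ⟨α, hα⟩ := τ₂.exists_right_lt h₂ ψ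
      refine ⟨α, ((hsnd _ _).trans hα.le).trans ?_⟩
      rw [add_comm r₁, add_assoc]
      exact le_self_add

/-! ### Triangle inequality and finiteness of the propinquity -/

theorem propinquity_triangle {T : TunnelClass.{u}} (hT : ClosedUnderComposition T)
    (A B E : LeibnizQCMS.{u}) :
    propinquity T A E ≤ propinquity T A B + propinquity T B E := by
  -- The right side may be assumed finite; both infima are then finite, so adding a positive amount
  -- exceeds them strictly and nearly optimal tunnels exist.
  refine ENNReal.le_of_forall_pos_le_add fun η hη hfin => ?_
  obtain ⟨hAB, hBE⟩ := ENNReal.add_lt_top.1 hfin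
  -- The error budget: η/4 for each tunnel and 2δ ≤ η/2 for the bridge, with δ ≤ η/4.
  have hη4 : (0 : ℝ) < η / 4 := div_pos (by exact_mod_cast hη) (by norm_num)
  have hη4' : ENNReal.ofReal (η / 4) ≠ 0 := by simpa using hη
  obtain ⟨τ₁, hτ₁, h₁⟩ : ∃ τ ∈ T A B, τ.extent < propinquity T A B + ENNReal.ofReal (η / 4) := by
    simpa only [propinquity, iInf_lt_iff, exists_prop] using
      ENNReal.lt_add_right hAB.ne hη4'
  obtain ⟨τ₂, hτ₂, h₂⟩ : ∃ τ ∈ T B E, τ.extent < propinquity T B E + ENNReal.ofReal (η / 4) := by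
    simpa only [propinquity, iInf_lt_iff, exists_prop] using
      ENNReal.lt_add_right hBE.ne hη4'
  obtain ⟨δ, hδ, hδη, hmem⟩ := hT (η / 4) hη4 A B E τ₁ τ₂ hτ₁ hτ₂
  calc propinquity T A E ≤ (Tunnel.comp δ hδ τ₁ τ₂).extent := iInf₂_le _ hmem
    _ ≤ (propinquity T A B + ENNReal.ofReal (η / 4)) +
        (propinquity T B E + ENNReal.ofReal (η / 4)) + ENNReal.ofReal (2 * δ) :=
      Tunnel.extent_comp_le hδ τ₁ τ₂ h₁ h₂
    _ = propinquity T A B + propinquity T B E +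
        ENNReal.ofReal (η / 4 + η / 4 + 2 * δ) := by
      rw [ENNReal.ofReal_add (by positivity) (by positivity),
        ENNReal.ofReal_add hη4.le hη4.le]
      ring
    _ ≤ propinquity T A B + propinquity T B E + η := by
      gcongr
      rw [← ENNReal.ofReal_coe_nnreal]
      exact ENNReal.ofReal_le_ofReal (by linarith)

theorem propinquity_lt_top {T : TunnelClass.{u}} {A B : LeibnizQCMS.{u}}
    (h : (T A B).Nonempty) : propinquity T A B < ⊤ := by
  obtain ⟨τ, hτ⟩ := h
  exact (iInf₂_le τ hτ).trans_lt τ.extent_lt_top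

theorem mainTheorem3 (C : Set LeibnizQCMS.{u}) (hC : C.Nonempty) (T : TunnelClass.{u})
    (hT : IsAppropriate C T) :
    (∀ A ∈ C, ∀ B ∈ C, propinquity T A B < ⊤) ∧
    (∀ A ∈ C, ∀ B ∈ C, ∀ E ∈ C,
      propinquity T A E ≤ propinquity T A B + propinquity T B E) :=
  ⟨fun A hA B hB => propinquity_lt_top (hT.exists_tunnel A hA B hB),
    fun A _ B _ E _ => propinquity_triangle hT.closedUnderComposition A B E⟩
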